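/- For real $p,r$ let $A_0(p,r)=1$ and $A_m(p,r)=\frac{r}{m!}\prod_{i=1}^{m-1}(mp+r-i)$ for $m\ge 1$. For $p=3/2$ and each $r\in\{1/2,\,1,\,3/2\}$ there is exactly one probability measure $\mu(p,r)$ on $\mathbb{R}$ whose moment sequence is $\left(A_m(p,r)\right)_{m\ge 0}$, and it has exactly one density $W_{p,r}$ with respect to Lebesgue measure that is nonnegative, continuous on $(0,3\sqrt3/2)$ and zero outside this interval. For all $x\in(0,3\sqrt3/2)$, $$W_{3/2,1/2}(x)=\frac{\left(1+\sqrt{1-4x^2/27}\right)^{2/3}-\left(1-\sqrt{1-4x^2/27}\right)^{2/3}}{2^{5/3}\,3^{-1/2}\,\pi\, x^{2/3}},$$ $$W_{3/2,1}(x)=3^{1/2}\,\frac{\left(1+\sqrt{1-4x^2/27}\right)^{1/3}-\left(1-\sqrt{1-4x^2/27}\right)^{1/3}}{2^{4/3}\,\pi\, x^{1/3}}+3^{1/2}x^{1/3}\,\frac{\left(1+\sqrt{1-4x^2/27}\right)^{2/3}-\left(1-\sqrt{1-4x^2/27}\right)^{2/3}}{2^{5/3}\,\pi},$$ and $$W_{3/2,3/2}(x)=x\cdot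 W_{3/2,1}(x).$$ -/

import Mathlib

open MeasureTheory Set

/-- The Raney numbers (two-parameter Fuss-Catalan numbers)
`A_m(p,r) = (r / m!) * ∏_{i=1}^{m-1} (m p + r - i)`, with `A_0(p,r) = 1`. -/
noncomputable def raneyNumber (p r : ℝ) (m : ℕ) : ℝ :=
  if m = 0 then 1
  else r / (m.factorial : ℝ) * ∏ i ∈ Finset.Icc 1 (m - 1), ((m : ℝ) * p + r - (i : ℝ))

/-- `μ` is a probability measure on `ℝ` whose moments all exist and are the Raney numbers
`A_m(p,r)`. -/
structure IsRaneyMeasure (p r : ℝ) (μ : Measure ℝ) : Prop where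
  isProbabilityMeasure : IsProbabilityMeasure μ
  integrable_pow : ∀ m : ℕ, Integrable (fun x : ℝ => x ^ m) μ
  moment_eq : ∀ m : ℕ, ∫ x, x ^ m ∂μ = raneyNumber p r m

/-- The measure `μ(p,r)`: the probability measure with moment sequence `A_m(p,r)`
(an arbitrary measure when there is none). -/
noncomputable def raneyMeasure (p r : ℝ) : Measure ℝ :=
  Classical.epsilon (IsRaneyMeasure p r)

/-- The right end point `c(p) = p^p (p-1)^(1-p)` of the support of `μ(p,r)`. -/
noncomputable def raneyEndpoint (p : ℝ) : ℝ := p ^ p * (p - 1) ^ (1 - p)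

/-- `W` is the density of `μ(p,r)` with respect to Lebesgue measure, in the version that is
continuous on the interval `(0, c(p))` and zero outside of it. -/
structure IsRaneyDensity (p r : ℝ) (W : ℝ → ℝ) : Prop where
  continuousOn : ContinuousOn W (Ioo 0 (raneyEndpoint p))
  eq_zero : ∀ x, x ∉ Ioo 0 (raneyEndpoint p) → W x = 0
  nonneg : ∀ x, 0 ≤ W x
  withDensity_eq : volume.withDensity (fun x => ENNReal.ofReal (W x)) = raneyMeasure p r

/-- The density `W_{p,r}` of `μ(p,r)` (an arbitrary function when there is none). -/
noncomputable def raneyDensity (p r : ℝ) : ℝ → ℝ :=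
  Classical.epsilon (IsRaneyDensity p r)

/-! A probability measure with the same moments as one carried by `[-C, C]` is itself carried by
`[-C, C]`, since its even moments grow no faster than `C ^ (2 * n)`. Both moment generating
functions are then entire with the same Taylor coefficients, so the measures coincide
(`eq_of_moments_eq_of_ae_abs_le`). It therefore suffices to check that each explicit function is
nonnegative and continuous on the interval and has the Raney numbers as moments
(`raney_of_moments`).

The moments are combinations of integrals of `x ^ β * ((1 + s) ^ α - (1 - s) ^ α)` with `s = √(1 - x
^ 2 / c ^ 2)`. Under `x = c √(4 t (1 - t))` the two terms come from the two halves of `(0, 1)` and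
combine into one integral over `(0, 1)`, a difference of beta integrals (`integral_rpow_mul_sub`).
On the other side, a two-step recurrence and the reflection formula put the Raney numbers into Gamma
form (`raneyNumber_half_eq_Gamma`, `raneyNumber_one_eq_Gamma`). The case `r = 3/2` follows from `r =
1`, because `A_m(p,p) = A_{m+1}(p,1)`. -/

/-! ### Determinacy of the moment problem for compactly supported measures. -/

open ProbabilityTheory Filter in
/-- A probability measure with finite exponential moments is determined by its moments. -/
theorem ext_of_moments_eq {μ ν : Measure ℝ} [IsProbabilityMeasure μ] [IsProbabilityMeasure ν]
    (hμ : ∀ t : ℝ, Integrable (fun x => Real.exp (t * x)) μ)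
    (hν : ∀ t : ℝ, Integrable (fun x => Real.exp (t * x)) ν)
    (h : ∀ m : ℕ, ∫ x, x ^ m ∂μ = ∫ x, x ^ m ∂ν) : μ = ν := by
  have eμ : integrableExpSet id μ = univ := eq_univ_of_forall hμ
  have eν : integrableExpSet id ν = univ := eq_univ_of_forall hν
  have iμ : interior (integrableExpSet id μ) = univ := by rw [eμ, interior_univ]
  have iν : interior (integrableExpSet id ν) = univ := by rw [eν, interior_univ]
  have aμ : AnalyticOnNhd ℝ (mgf id μ) univ := iμ ▸ analyticOnNhd_mgf
  have aν : AnalyticOnNhd ℝ (mgf id ν) univ := iν ▸ analyticOnNhd_mgf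
  have sμ := hasFPowerSeriesAt_mgf (X := id) (μ := μ) (v := 0) (by simp [iμ])
  have sν := hasFPowerSeriesAt_mgf (X := id) (μ := ν) (v := 0) (by simp [iν])
  have hs : mgf id μ =ᶠ[nhds 0] mgf id ν := by
    -- At `0` the Taylor coefficients are the moments over factorials, so the two series agree.
    simp only [id, zero_mul, Real.exp_zero, mul_one, h] at sμ sν
    have hsub := sμ.sub sν
    rw [sub_self] at hsub
    filter_upwards [hsub.eventually_eq_zero] with z hz
    exact sub_eq_zero.mp hz
  have hm : mgf id μ = mgf id ν := aμ.eq_of_eventuallyEq aν hs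
  refine Measure.ext_of_complexMGF_id_eq ?_
  ext z
  exact eqOn_complexMGF_of_mgf hm (by simp [iμ])

/-- A probability measure whose even moments are dominated by the powers of `C` is concentrated
on `[-C, C]`. -/
theorem ae_abs_le_of_even_moments_le {μ : Measure ℝ} [IsProbabilityMeasure μ] {C : ℝ}
    (hC : 0 ≤ C) (hi : ∀ m : ℕ, Integrable (fun x : ℝ => x ^ m) μ)
    (h : ∀ n : ℕ, ∫ x, x ^ (2 * n) ∂μ ≤ C ^ (2 * n)) : ∀ᵐ x ∂μ, |x| ≤ C := by
  -- Markov's inequality for `x ^ (2 * n)` bounds this mass by `(C / a) ^ (2 * n)`, which tends to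
  -- `0`.
  have key : ∀ a : ℝ, C < a → μ {x | a ≤ |x|} = 0 := by
    intro a ha
    have ha0 : 0 < a := hC.trans_lt ha
    have hle : ∀ n : ℕ, μ.real {x | a ≤ |x|} ≤ ((C / a) ^ 2) ^ n := by
      intro n
      have h1 := mul_meas_ge_le_integral_of_nonneg (μ := μ) (f := fun x : ℝ => x ^ (2 * n))
        (ae_of_all _ fun x => by simp only [pow_mul]; positivity) (hi (2 * n)) (a ^ (2 * n))
      have h2 : μ.real {x | a ≤ |x|} ≤ μ.real {x : ℝ | a ^ (2 * n) ≤ x ^ (2 * n)} := by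
        refine measureReal_mono fun x (hx : a ≤ |x|) => ?_
        have : x ^ (2 * n) = |x| ^ (2 * n) := by rw [pow_mul, pow_mul, sq_abs]
        simp only [mem_ofPred_eq, this]
        exact pow_le_pow_left₀ ha0.le hx _
      have hp : 0 < a ^ (2 * n) := pow_pos ha0 _
      rw [← pow_mul, div_pow, le_div_iff₀ hp]
      calc _ ≤ μ.real {x : ℝ | a ^ (2 * n) ≤ x ^ (2 * n)} * a ^ (2 * n) := by gcongr
        _ ≤ _ := by rw [mul_comm]; exact h1.trans (h n)
    have hq : (C / a) ^ 2 < 1 := by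
      have : C / a < 1 := (div_lt_one ha0).2 ha
      have : 0 ≤ C / a := by positivity
      nlinarith
    have h0 : μ.real {x | a ≤ |x|} ≤ 0 :=
      ge_of_tendsto' (tendsto_pow_atTop_nhds_zero_of_lt_one (by positivity) hq) hle
    exact (measureReal_eq_zero_iff (measure_ne_top _ _)).1
      (le_antisymm h0 measureReal_nonneg)
  have hall : ∀ n : ℕ, ∀ᵐ x ∂μ, |x| < C + 1 / ((n : ℝ) + 1) := by
    intro n
    have := key (C + 1 / ((n : ℝ) + 1)) (lt_add_of_pos_right _ (by positivity))
    simpa [ae_iff] using this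
  filter_upwards [ae_all_iff.2 hall] with x hx
  have ht := (tendsto_one_div_add_atTop_nhds_zero_nat (𝕜 := ℝ)).const_add C
  rw [add_zero] at ht
  exact ge_of_tendsto' ht fun n => (hx n).le

theorem integrable_exp_of_ae_abs_le {μ : Measure ℝ} [IsFiniteMeasure μ] {C : ℝ}
    (h : ∀ᵐ x ∂μ, |x| ≤ C) (t : ℝ) : Integrable (fun x => Real.exp (t * x)) μ := by
  refine Integrable.of_bound (C := Real.exp (|t| * C)) (by fun_prop) ?_
  filter_upwards [h] with x hx
  rw [Real.norm_eq_abs, Real.abs_exp, Real.exp_le_exp]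
  calc t * x ≤ |t * x| := le_abs_self _
    _ = |t| * |x| := abs_mul _ _
    _ ≤ _ := by gcongr

/-- A compactly supported probability measure is determined by its moments among all
probability measures. -/
theorem eq_of_moments_eq_of_ae_abs_le {μ ν : Measure ℝ} [IsProbabilityMeasure μ]
    [IsProbabilityMeasure ν] {C : ℝ} (hC : 0 ≤ C) (hν : ∀ᵐ x ∂ν, |x| ≤ C)
    (hi : ∀ m : ℕ, Integrable (fun x : ℝ => x ^ m) μ)
    (hiν : ∀ m : ℕ, Integrable (fun x : ℝ => x ^ m) ν)
    (h : ∀ m : ℕ, ∫ x, x ^ m ∂μ = ∫ x, x ^ m ∂ν) : μ = ν := by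
  -- No support condition is assumed on `μ`; it is recovered from the even moments shared with `ν`.
  refine ext_of_moments_eq (integrable_exp_of_ae_abs_le
    (ae_abs_le_of_even_moments_le hC hi fun n => ?_)) (integrable_exp_of_ae_abs_le hν) h
  rw [h]
  calc ∫ x, x ^ (2 * n) ∂ν ≤ ∫ _, C ^ (2 * n) ∂ν := by
        refine integral_mono_ae (hiν _) (integrable_const _) ?_
        filter_upwards [hν] with x hx
        rw [show x ^ (2 * n) = |x| ^ (2 * n) by rw [pow_mul, pow_mul, sq_abs]]
        exact pow_le_pow_left₀ (abs_nonneg _) hx _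
    _ = _ := by simp

/-! ### Real beta integrals. -/

section Beta

open ProbabilityTheory

theorem ofReal_beta_integrand {a b t : ℝ} (ht : t ∈ Ioo (0 : ℝ) 1) :
    ((t : ℂ) ^ ((a : ℂ) - 1) * (1 - (t : ℂ)) ^ ((b : ℂ) - 1)) =
      ((t ^ (a - 1) * (1 - t) ^ (b - 1) : ℝ) : ℂ) := by
  rw [Complex.ofReal_mul, Complex.ofReal_cpow ht.1.le, Complex.ofReal_cpow (sub_nonneg.2 ht.2.le)]
  push_cast
  rfl

theorem integrableOn_beta_integrand {a b : ℝ} (ha : 0 < a) (hb : 0 < b) :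
    IntegrableOn (fun t : ℝ => t ^ (a - 1) * (1 - t) ^ (b - 1)) (Ioo 0 1) := by
  have h := Complex.betaIntegral_convergent (u := a) (v := b) (by simpa) (by simpa)
  rw [intervalIntegrable_iff_integrableOn_Ioo_of_le zero_le_one] at h
  have h2 := IntegrableOn.congr_fun h (fun t ht => ofReal_beta_integrand ht) measurableSet_Ioo
  simpa [IntegrableOn] using h2.re

theorem setIntegral_beta_integrand {a b : ℝ} (ha : 0 < a) (hb : 0 < b) :
    ∫ t in Ioo (0 : ℝ) 1, t ^ (a - 1) * (1 - t) ^ (b - 1) =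
      Real.Gamma a * Real.Gamma b / Real.Gamma (a + b) := by
  have h : Complex.betaIntegral a b =
      ((∫ t in Ioo (0 : ℝ) 1, t ^ (a - 1) * (1 - t) ^ (b - 1) : ℝ) : ℂ) := by
    rw [Complex.betaIntegral, intervalIntegral.integral_of_le zero_le_one,
      integral_Ioc_eq_integral_Ioo]
    exact (setIntegral_congr_fun measurableSet_Ioo fun t ht => ofReal_beta_integrand ht).trans
      integral_ofReal
  have h2 := beta_eq_betaIntegralReal a b ha hb
  rw [h, Complex.ofReal_re] at h2
  exact h2.symm

/-- The difference of two neighbouring beta integrals. -/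
theorem integral_two_mul_sub_one_beta {a α : ℝ} (ha : 0 < a) (hα : 0 < α) :
    IntegrableOn (fun t : ℝ => (2 * t - 1) * (t ^ (a + α - 1) * (1 - t) ^ (a - 1))) (Ioo 0 1) ∧
    ∫ t in Ioo (0 : ℝ) 1, (2 * t - 1) * (t ^ (a + α - 1) * (1 - t) ^ (a - 1)) =
      α * Real.Gamma (a + α) * Real.Gamma a / Real.Gamma (2 * a + α + 1) := by
  -- Writing `2 * t - 1 = t - (1 - t)` raises one of the two beta parameters by one in each term.
  have e : EqOn (fun t : ℝ => t ^ (a + α + 1 - 1) * (1 - t) ^ (a - 1)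
        - t ^ (a + α - 1) * (1 - t) ^ (a + 1 - 1))
      (fun t : ℝ => (2 * t - 1) * (t ^ (a + α - 1) * (1 - t) ^ (a - 1))) (Ioo 0 1) := by
    intro t ht
    have h1 : t ^ (a + α + 1 - 1) = t ^ (a + α - 1) * t := by
      rw [← Real.rpow_add_one ht.1.ne']; ring_nf
    have h2 : (1 - t) ^ (a + 1 - 1) = (1 - t) ^ (a - 1) * (1 - t) := by
      rw [← Real.rpow_add_one (sub_pos.2 ht.2).ne']; ring_nf
    simp only [h1, h2]
    ring
  have i1 := integrableOn_beta_integrand (a := a + α + 1) (b := a) (by positivity) ha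
  have i2 := integrableOn_beta_integrand (a := a + α) (b := a + 1) (by positivity) (by positivity)
  refine ⟨(i1.sub i2).congr_fun e measurableSet_Ioo, ?_⟩
  rw [← setIntegral_congr_fun measurableSet_Ioo e, integral_sub i1 i2,
    setIntegral_beta_integrand (by positivity) ha,
    setIntegral_beta_integrand (by positivity) (by positivity),
    Real.Gamma_add_one (by positivity), Real.Gamma_add_one (by positivity),
    show a + α + 1 + a = 2 * a + α + 1 by ring, show a + α + (a + 1) = 2 * a + α + 1 by ring]
  ring

end Beta

/-! ### The substitution `x = c √(4 t (1 - t))`. -/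

section ArcSubstitution

/-- The substitution `t ↦ c √(4 t (1 - t))`, which maps each half of `(0, 1)` onto `(0, c)`. -/
noncomputable def arcMap (c t : ℝ) : ℝ := c * √(4 * (t * (1 - t)))

theorem hasDerivAt_arcMap {c t : ℝ} (ht : t ∈ Ioo (0 : ℝ) 1) :
    HasDerivAt (arcMap c) (c * (2 * (1 - 2 * t) / √(4 * (t * (1 - t))))) t := by
  have hp : 0 < t * (1 - t) := mul_pos ht.1 (sub_pos.2 ht.2)
  have h : HasDerivAt (fun t : ℝ => 4 * (t * (1 - t))) (4 * (1 * (1 - t) + t * (-1))) t :=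
    ((hasDerivAt_id t).mul ((hasDerivAt_id t).const_sub 1)).const_mul 4
  convert! (h.sqrt (by positivity)).const_mul c using 2
  field_simp
  ring

theorem arcMap_sq {c t : ℝ} (ht : t ∈ Ioo (0 : ℝ) 1) :
    arcMap c t ^ 2 = c ^ 2 * (4 * (t * (1 - t))) := by
  have hp : 0 < t * (1 - t) := mul_pos ht.1 (sub_pos.2 ht.2)
  rw [arcMap, mul_pow, Real.sq_sqrt (by positivity)]

/-- This is `1 - 4 t (1 - t) = (2 t - 1) ^ 2`. The absolute value is why the two halves of `(0, 1)`
are treated separately. -/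
theorem sqrt_one_sub_arcMap {c t : ℝ} (hc : 0 < c) (ht : t ∈ Ioo (0 : ℝ) 1) :
    √(1 - arcMap c t ^ 2 / c ^ 2) = |2 * t - 1| := by
  rw [arcMap_sq ht, mul_div_cancel_left₀ _ (by positivity), ← Real.sqrt_sq_eq_abs]
  ring_nf

theorem sqrt_one_sub_mem {c x : ℝ} (hx : x ∈ Ioo 0 c) : √(1 - x ^ 2 / c ^ 2) ∈ Ioo (0 : ℝ) 1 := by
  have hc : 0 < c := hx.1.trans hx.2
  have h1 : x ^ 2 / c ^ 2 < 1 := by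
    rw [div_lt_one (by positivity)]
    exact pow_lt_pow_left₀ hx.2 hx.1.le two_ne_zero
  have h2 : 0 < x ^ 2 / c ^ 2 := div_pos (pow_pos hx.1 2) (by positivity)
  refine ⟨Real.sqrt_pos.2 (by linarith), ?_⟩
  rw [Real.sqrt_lt' one_pos]
  linarith

theorem arcMap_mem {c t : ℝ} (hc : 0 < c) (ht : t ∈ Ioo (0 : ℝ) 1) (ht' : t ≠ 1 / 2) :
    arcMap c t ∈ Ioo 0 c := by
  have hp : 0 < t * (1 - t) := mul_pos ht.1 (sub_pos.2 ht.2)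
  refine ⟨mul_pos hc (Real.sqrt_pos.2 (by positivity)), ?_⟩
  have : √(4 * (t * (1 - t))) < 1 := by
    rw [Real.sqrt_lt' one_pos]
    have : 0 < (t - 1 / 2) ^ 2 := by have := sub_ne_zero.2 ht'; positivity
    nlinarith
  rw [arcMap]
  nlinarith

theorem arcMap_one_add_sqrt {c x : ℝ} (hx : x ∈ Ioo 0 c) :
    arcMap c ((1 + √(1 - x ^ 2 / c ^ 2)) / 2) = x ∧
      arcMap c ((1 - √(1 - x ^ 2 / c ^ 2)) / 2) = x := by
  have hc : 0 < c := hx.1.trans hx.2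
  have hs : √(1 - x ^ 2 / c ^ 2) ^ 2 = 1 - x ^ 2 / c ^ 2 :=
    Real.sq_sqrt (Real.sqrt_pos.1 (sqrt_one_sub_mem hx).1).le
  have h : c * √((x / c) ^ 2) = x := by
    rw [Real.sqrt_sq (div_nonneg hx.1.le hc.le), mul_div_cancel₀ _ hc.ne']
  constructor
  · rw [arcMap, ← h]
    congr 2
    rw [h]
    rw [div_pow]
    linarith
  · rw [arcMap, ← h]
    congr 2
    rw [h]
    rw [div_pow]
    linarith

theorem image_arcMap_right {c : ℝ} (hc : 0 < c) : arcMap c '' Ioo (1 / 2) 1 = Ioo 0 c := by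
  ext x
  constructor
  · rintro ⟨t, ht, rfl⟩
    exact arcMap_mem hc ⟨by linarith [ht.1], ht.2⟩ ht.1.ne'
  · intro hx
    have hs := sqrt_one_sub_mem hx
    exact ⟨_, ⟨by linarith [hs.1], by linarith [hs.2]⟩, (arcMap_one_add_sqrt hx).1⟩

theorem image_arcMap_left {c : ℝ} (hc : 0 < c) : arcMap c '' Ioo 0 (1 / 2) = Ioo 0 c := by
  ext x
  constructor
  · rintro ⟨t, ht, rfl⟩
    exact arcMap_mem hc ⟨ht.1, by linarith [ht.2]⟩ ht.2.ne
  · intro hx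
    have hs := sqrt_one_sub_mem hx
    exact ⟨_, ⟨by linarith [hs.2], by linarith [hs.1]⟩, (arcMap_one_add_sqrt hx).2⟩

/-- Squaring gives `t (1 - t) = u (1 - u)`, and the difference of the two sides factors. Injectivity
on each half follows. -/
theorem eq_or_eq_one_sub_of_arcMap_eq {c t u : ℝ} (hc : 0 < c) (ht : t ∈ Ioo (0 : ℝ) 1)
    (hu : u ∈ Ioo (0 : ℝ) 1) (h : arcMap c t = arcMap c u) : t = u ∨ t = 1 - u := by
  have h2 := congrArg (· ^ 2) h
  simp only [arcMap_sq ht, arcMap_sq hu] at h2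
  have h3 : (t - u) * (1 - u - t) = 0 := by
    have := mul_left_cancel₀ (by positivity) h2
    linarith
  rcases mul_eq_zero.1 h3 with h | h
  · left; linarith
  · right; linarith

theorem injOn_arcMap_right {c : ℝ} (hc : 0 < c) : InjOn (arcMap c) (Ioo (1 / 2) 1) := by
  intro t ht u hu h
  rcases eq_or_eq_one_sub_of_arcMap_eq hc ⟨by linarith [ht.1], ht.2⟩
    ⟨by linarith [hu.1], hu.2⟩ h with h | h
  · exact h
  · linarith [ht.1, hu.1]

theorem injOn_arcMap_left {c : ℝ} (hc : 0 < c) : InjOn (arcMap c) (Ioo 0 (1 / 2)) := by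
  intro t ht u hu h
  rcases eq_or_eq_one_sub_of_arcMap_eq hc ⟨ht.1, by linarith [ht.2]⟩
    ⟨hu.1, by linarith [hu.2]⟩ h with h | h
  · exact h
  · linarith [ht.2, hu.2]

/-- The integrand `x ^ β (2 t) ^ α dx` after the substitution `x = c √(4 t (1 - t))`. -/
theorem arcMap_rpow_mul {c t β α : ℝ} (hc : 0 < c) (ht : t ∈ Ioo (0 : ℝ) 1) :
    c * (2 * (2 * t - 1) / √(4 * (t * (1 - t)))) * (arcMap c t ^ β * (2 * t) ^ α) =
      c ^ (β + 1) * 2 ^ (β + α) *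
        ((2 * t - 1) * (t ^ ((β + 1) / 2 + α - 1) * (1 - t) ^ ((β + 1) / 2 - 1))) := by
  obtain ⟨h0, h1⟩ := ht
  have h1' : 0 < 1 - t := sub_pos.2 h1
  have hs : √(4 * (t * (1 - t))) = 2 * t ^ (1 / 2 : ℝ) * (1 - t) ^ (1 / 2 : ℝ) := by
    rw [Real.sqrt_mul (by norm_num), Real.sqrt_mul h0.le, show (4 : ℝ) = 2 ^ 2 by norm_num,
      Real.sqrt_sq (by norm_num), Real.sqrt_eq_rpow, Real.sqrt_eq_rpow, mul_assoc]
  have e1 : t ^ ((β + 1) / 2 + α - 1) = t ^ (β / 2) * t ^ α / t ^ (1 / 2 : ℝ) := by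
    rw [← Real.rpow_add h0, ← Real.rpow_sub h0]; ring_nf
  have e2 : (1 - t) ^ ((β + 1) / 2 - 1) = (1 - t) ^ (β / 2) / (1 - t) ^ (1 / 2 : ℝ) := by
    rw [← Real.rpow_sub h1']; ring_nf
  have e3 : arcMap c t ^ β = c ^ β * 2 ^ β * t ^ (β / 2) * (1 - t) ^ (β / 2) := by
    rw [arcMap, hs, Real.mul_rpow hc.le (by positivity), Real.mul_rpow (by positivity)
      (by positivity), Real.mul_rpow (by positivity) (by positivity), ← Real.rpow_mul h0.le,
      ← Real.rpow_mul h1'.le]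
    ring_nf
  rw [e1, e2, e3, hs, Real.mul_rpow (by norm_num) h0.le, Real.rpow_add_one hc.ne',
    Real.rpow_add two_pos]
  field_simp

/-- The Mellin-type integral that gives the moments of the densities. -/
theorem integral_rpow_mul_sub {c β α : ℝ} (hc : 0 < c) (hβ : -1 < β) (hα : 0 < α) :
    IntegrableOn (fun x : ℝ => x ^ β *
      ((1 + √(1 - x ^ 2 / c ^ 2)) ^ α - (1 - √(1 - x ^ 2 / c ^ 2)) ^ α)) (Ioo 0 c) ∧
    ∫ x in Ioo 0 c, x ^ β *
      ((1 + √(1 - x ^ 2 / c ^ 2)) ^ α - (1 - √(1 - x ^ 2 / c ^ 2)) ^ α) =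
      c ^ (β + 1) * 2 ^ (β + α) * (α * Real.Gamma ((β + 1) / 2 + α) * Real.Gamma ((β + 1) / 2) /
        Real.Gamma (β + α + 2)) := by
  obtain ⟨hI, hv⟩ := integral_two_mul_sub_one_beta (a := (β + 1) / 2) (by linarith) hα
  set g : ℝ → ℝ := fun t =>
    (2 * t - 1) * (t ^ ((β + 1) / 2 + α - 1) * (1 - t) ^ ((β + 1) / 2 - 1)) with hg
  set K : ℝ := c ^ (β + 1) * 2 ^ (β + α) with hK
  set D : ℝ → ℝ := fun t => c * (2 * (1 - 2 * t) / √(4 * (t * (1 - t)))) with hD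
  set P : ℝ → ℝ := fun x => x ^ β * (1 + √(1 - x ^ 2 / c ^ 2)) ^ α with hP
  set M : ℝ → ℝ := fun x => x ^ β * (1 - √(1 - x ^ 2 / c ^ 2)) ^ α with hM
  have sR : Ioo (1 / 2 : ℝ) 1 ⊆ Ioo 0 1 := Ioo_subset_Ioo_left (by norm_num)
  have sL : Ioo (0 : ℝ) (1 / 2) ⊆ Ioo 0 1 := Ioo_subset_Ioo_right (by norm_num)
  -- On the right half the root is `2 * t - 1`, so `1 + √… = 2 * t`.
  have eR : EqOn (fun t => |D t| • P (arcMap c t)) (fun t => K * g t) (Ioo (1 / 2) 1) := by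
    intro t ht
    have h := arcMap_rpow_mul (β := β) (α := α) hc (sR ht)
    have hneg : D t ≤ 0 :=
      mul_nonpos_of_nonneg_of_nonpos hc.le
        (div_nonpos_of_nonpos_of_nonneg (by linarith [ht.1]) (Real.sqrt_nonneg _))
    have habs : |2 * t - 1| = 2 * t - 1 := abs_of_nonneg (by linarith [ht.1])
    simp only [hP, smul_eq_mul, sqrt_one_sub_arcMap hc (sR ht), habs, abs_of_nonpos hneg]
    rw [← h, hD, show 1 + (2 * t - 1) = 2 * t by ring]
    ring
  -- On the left half the root is `1 - 2 * t`, so now `1 - √… = 2 * t`: the same integrand up to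
  -- sign, and the sign cancels the minus in `P - M`.
  have eL : EqOn (fun t => |D t| • M (arcMap c t)) (fun t => -(K * g t)) (Ioo 0 (1 / 2)) := by
    intro t ht
    have h := arcMap_rpow_mul (β := β) (α := α) hc (sL ht)
    have hpos : 0 ≤ D t :=
      mul_nonneg hc.le (div_nonneg (by linarith [ht.2]) (Real.sqrt_nonneg _))
    have habs : |2 * t - 1| = -(2 * t - 1) := abs_of_nonpos (by linarith [ht.2])
    simp only [hM, smul_eq_mul, sqrt_one_sub_arcMap hc (sL ht), habs, abs_of_nonneg hpos]
    rw [← h, hD, show 1 - -(2 * t - 1) = 2 * t by ring]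
    ring
  have dR : ∀ t ∈ Ioo (1 / 2 : ℝ) 1, HasDerivWithinAt (arcMap c) (D t) (Ioo (1 / 2) 1) t :=
    fun t ht => (hasDerivAt_arcMap (sR ht)).hasDerivWithinAt
  have dL : ∀ t ∈ Ioo (0 : ℝ) (1 / 2), HasDerivWithinAt (arcMap c) (D t) (Ioo 0 (1 / 2)) t :=
    fun t ht => (hasDerivAt_arcMap (sL ht)).hasDerivWithinAt
  have iK : IntegrableOn (fun t => K * g t) (Ioo 0 1) := Integrable.const_mul hI K
  have iKR := iK.mono_set sR
  have iKL := iK.mono_set sL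
  have iP : IntegrableOn P (Ioo 0 c) := by
    rw [← image_arcMap_right hc, integrableOn_image_iff_integrableOn_abs_deriv_smul
      measurableSet_Ioo dR (injOn_arcMap_right hc)]
    exact iKR.congr_fun eR.symm measurableSet_Ioo
  have iM : IntegrableOn M (Ioo 0 c) := by
    rw [← image_arcMap_left hc, integrableOn_image_iff_integrableOn_abs_deriv_smul
      measurableSet_Ioo dL (injOn_arcMap_left hc)]
    exact IntegrableOn.congr_fun iKL.neg eL.symm measurableSet_Ioo
  have vP : ∫ x in Ioo 0 c, P x = ∫ t in Ioo (1 / 2 : ℝ) 1, K * g t := by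
    rw [← image_arcMap_right hc, integral_image_eq_integral_abs_deriv_smul
      measurableSet_Ioo dR (injOn_arcMap_right hc)]
    exact setIntegral_congr_fun measurableSet_Ioo eR
  have vM : ∫ x in Ioo 0 c, M x = -∫ t in Ioo (0 : ℝ) (1 / 2), K * g t := by
    rw [← image_arcMap_left hc, integral_image_eq_integral_abs_deriv_smul
      measurableSet_Ioo dL (injOn_arcMap_left hc), ← integral_neg]
    exact setIntegral_congr_fun measurableSet_Ioo eL
  have hPM : (fun x : ℝ => x ^ β *
      ((1 + √(1 - x ^ 2 / c ^ 2)) ^ α - (1 - √(1 - x ^ 2 / c ^ 2)) ^ α)) = fun x => P x - M x := by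
    funext x
    simp only [hP, hM]
    ring
  rw [hPM]
  refine ⟨iP.sub iM, ?_⟩
  have split : ∫ t in Ioo (0 : ℝ) 1, K * g t =
      (∫ t in Ioo (0 : ℝ) (1 / 2), K * g t) + ∫ t in Ioo (1 / 2 : ℝ) 1, K * g t := by
    rw [← integral_Ico_eq_integral_Ioo (x := (1 / 2 : ℝ)), ← setIntegral_union _ measurableSet_Ico
      iKL ((integrableOn_Ico_iff_integrableOn_Ioo).2 iKR),
      Ioo_union_Ico_eq_Ioo (by norm_num) (by norm_num)]
    exact Set.disjoint_left.2 fun t h1 h2 => absurd h1.2 (not_lt.2 h2.1)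
  rw [integral_sub iP iM, vP, vM, sub_neg_eq_add, add_comm, ← split, integral_const_mul, hv,
    show 2 * ((β + 1) / 2) + α + 1 = β + α + 2 by ring]

end ArcSubstitution

/-! ### Raney numbers: recurrence and Gamma form. -/

section RaneyNumber

theorem prod_Icc_one_eq_prod_range (f : ℕ → ℝ) (n : ℕ) :
    ∏ i ∈ Finset.Icc 1 n, f i = ∏ i ∈ Finset.range n, f (i + 1) := by
  induction n with
  | zero => simp
  | succ n ih => rw [Finset.prod_Icc_succ_top (by omega), ih, Finset.prod_range_succ]

theorem raneyNumber_zero (p r : ℝ) : raneyNumber p r 0 = 1 := if_pos rfl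

theorem raneyNumber_succ (p r : ℝ) (m : ℕ) :
    raneyNumber p r (m + 1) =
      r / ((m + 1).factorial : ℝ) * ∏ i ∈ Finset.range m, (((m : ℝ) + 1) * p + r - ((i : ℝ) + 1)) := by
  rw [raneyNumber, if_neg m.succ_ne_zero, prod_Icc_one_eq_prod_range]
  simp

theorem raneyNumber_one (p r : ℝ) : raneyNumber p r 1 = r := by
  simp [raneyNumber_succ]

/-- For `m ≥ 1` the first factor on the right is `(m + 1) * p`; it absorbs the extra factorial
factor and supplies the prefactor `p`. The other factors coincide. -/
theorem raneyNumber_self_eq (p : ℝ) (m : ℕ) : raneyNumber p p m = raneyNumber p 1 (m + 1) := by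
  rcases m with _ | m
  · rw [raneyNumber_zero, raneyNumber_one]
  · rw [raneyNumber_succ, raneyNumber_succ, Finset.prod_range_succ', Nat.factorial_succ (m + 1)]
    have h : ∀ i : ℕ, ((m + 1 : ℕ) + 1 : ℝ) * p + 1 - (((i + 1 : ℕ) : ℝ) + 1) =
        ((m : ℝ) + 1) * p + p - ((i : ℝ) + 1) := by
      intro i; push_cast; ring
    simp only [h]
    have : ((m + 1).factorial : ℝ) ≠ 0 := by positivity
    have : (m : ℝ) + 2 ≠ 0 := by positivity
    push_cast
    field_simp
    ring

/-- The two-step recurrence of the Raney numbers with `p = 3/2`. -/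
theorem raneyNumber_three_halves_add_two (r : ℝ) (m : ℕ) :
    raneyNumber (3 / 2) r (m + 2) * ((m / 2 + r + 1) * ((m + 1) * (m + 2))) =
      raneyNumber (3 / 2) r m *
        ((3 * m / 2 + r + 2) * (3 * m / 2 + r + 1) * (3 * m / 2 + r)) := by
  rcases m with _ | m
  · simp [raneyNumber_succ, raneyNumber_zero]
    ring
  · have key : (∏ i ∈ Finset.range (m + 2), (((m + 2 : ℕ) + 1 : ℝ) * (3 / 2) + r - ((i : ℝ) + 1))) *
        (((m + 1 : ℕ) : ℝ) / 2 + r + 1) =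
        (∏ i ∈ Finset.range m, (((m : ℝ) + 1) * (3 / 2) + r - ((i : ℝ) + 1))) *
        ((3 * ((m + 1 : ℕ) : ℝ) / 2 + r + 2) * (3 * ((m + 1 : ℕ) : ℝ) / 2 + r + 1) *
          (3 * ((m + 1 : ℕ) : ℝ) / 2 + r)) := by
      -- Raising the index by two shifts `m * p` by exactly `3`. Appending this one factor at the
      -- end and removing three at the front turns the longer product into the shorter one.
      have e : ((m + 1 : ℕ) : ℝ) / 2 + r + 1 =
          ((m + 2 : ℕ) + 1 : ℝ) * (3 / 2) + r - (((m + 2 : ℕ) : ℝ) + 1) := by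
        push_cast; ring
      rw [e, ← Finset.prod_range_succ
        (fun i : ℕ => ((m + 2 : ℕ) + 1 : ℝ) * (3 / 2) + r - ((i : ℝ) + 1)) (m + 2),
        Finset.prod_range_succ', Finset.prod_range_succ', Finset.prod_range_succ']
      have h : ∀ i : ℕ, ((m + 2 : ℕ) + 1 : ℝ) * (3 / 2) + r - (((i + 1 + 1 + 1 : ℕ) : ℝ) + 1) =
          ((m : ℝ) + 1) * (3 / 2) + r - ((i : ℝ) + 1) := by
        intro i; push_cast; ring
      simp only [h]
      push_cast
      ring
    rw [show m + 1 + 2 = (m + 2) + 1 by ring, raneyNumber_succ, raneyNumber_succ,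
      Nat.factorial_succ (m + 2), Nat.factorial_succ (m + 1)]
    have : ((m + 1).factorial : ℝ) ≠ 0 := by positivity
    have : (m : ℝ) + 2 ≠ 0 := by positivity
    have : (m : ℝ) + 3 ≠ 0 := by positivity
    push_cast at key ⊢
    generalize ∏ i ∈ Finset.range (m + 2), (((m : ℝ) + 2 + 1) * (3 / 2) + r - ((i : ℝ) + 1)) = Q
      at key ⊢
    generalize ∏ i ∈ Finset.range m, (((m : ℝ) + 1) * (3 / 2) + r - ((i : ℝ) + 1)) = R at key ⊢
    field_simp at key ⊢
    linear_combination (r * (m + 3)) * key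

/-- Both sides obey the same two-step recurrence, each Gamma argument growing by one per step. Even
and odd indices start from the reflection formula at `1/6` and `1/3` respectively. -/
theorem raneyNumber_half_eq_Gamma (m : ℕ) :
    raneyNumber (3 / 2) (1 / 2) m =
      (3 * √3) ^ m * (Real.Gamma (m / 2 + 5 / 6) * Real.Gamma (m / 2 + 1 / 6)) /
        (2 * Real.pi * (m + 1).factorial) := by
  induction m using Nat.twoStepInduction with
  | zero =>
    have h := Real.Gamma_mul_Gamma_one_sub (1 / 6)
    rw [show Real.pi * (1 / 6) = Real.pi / 6 by ring, Real.sin_pi_div_six,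
      show (1 : ℝ) - 1 / 6 = 5 / 6 by norm_num] at h
    have := Real.pi_pos
    norm_num [raneyNumber_zero]
    rw [mul_comm, h]
    field_simp
  | one =>
    have h := Real.Gamma_mul_Gamma_one_sub (1 / 3)
    rw [show Real.pi * (1 / 3) = Real.pi / 3 by ring, Real.sin_pi_div_three,
      show (1 : ℝ) - 1 / 3 = 2 / 3 by norm_num] at h
    have h2 : Real.Gamma (4 / 3) = 1 / 3 * Real.Gamma (1 / 3) := by
      rw [← Real.Gamma_add_one (by norm_num)]; norm_num
    have := Real.pi_pos
    norm_num [raneyNumber_one]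
    rw [h2, mul_assoc (1 / 3), h]
    field_simp
  | more m ih _ =>
    have hr := raneyNumber_three_halves_add_two (1 / 2) m
    rw [ih] at hr
    have g1 : Real.Gamma (((m + 2 : ℕ) : ℝ) / 2 + 5 / 6) =
        ((m : ℝ) / 2 + 5 / 6) * Real.Gamma (m / 2 + 5 / 6) := by
      rw [← Real.Gamma_add_one (by positivity)]; push_cast; ring_nf
    have g2 : Real.Gamma (((m + 2 : ℕ) : ℝ) / 2 + 1 / 6) =
        ((m : ℝ) / 2 + 1 / 6) * Real.Gamma (m / 2 + 1 / 6) := by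
      rw [← Real.Gamma_add_one (by positivity)]; push_cast; ring_nf
    rw [g1, g2]
    have h3 : (3 * √3) ^ (m + 2) = (3 * √3) ^ m * 27 := by
      rw [pow_add, mul_pow _ _ 2, Real.sq_sqrt (by norm_num)]; norm_num
    rw [h3, Nat.factorial_succ (m + 2), Nat.factorial_succ (m + 1)]
    have hpos : (0 : ℝ) < (m / 2 + 1 / 2 + 1) * ((m + 1) * (m + 2)) := by positivity
    rw [← mul_left_inj' hpos.ne', hr]
    have := Real.pi_pos
    have : ((m + 1).factorial : ℝ) ≠ 0 := by positivity
    push_cast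
    generalize Real.Gamma (m / 2 + 5 / 6) = G1
    generalize Real.Gamma (m / 2 + 1 / 6) = G2
    field_simp
    ring

/-- Same recurrence argument as for `r = 1/2`, with the reflection points `1/6` and `1/3`
interchanged. -/
theorem raneyNumber_one_eq_Gamma (m : ℕ) :
    raneyNumber (3 / 2) 1 m =
      √3 * (3 * √3) ^ m * (Real.Gamma (m / 2 + 2 / 3) * Real.Gamma (m / 2 + 1 / 3)) * (m + 1) /
        (Real.pi * (m + 2).factorial) := by
  induction m using Nat.twoStepInduction with
  | zero =>
    have h := Real.Gamma_mul_Gamma_one_sub (1 / 3)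
    rw [show Real.pi * (1 / 3) = Real.pi / 3 by ring, Real.sin_pi_div_three,
      show (1 : ℝ) - 1 / 3 = 2 / 3 by norm_num] at h
    have := Real.pi_pos
    norm_num [raneyNumber_zero]
    rw [mul_comm (Real.Gamma _), h]
    field_simp
  | one =>
    have h := Real.Gamma_mul_Gamma_one_sub (1 / 6)
    rw [show Real.pi * (1 / 6) = Real.pi / 6 by ring, Real.sin_pi_div_six,
      show (1 : ℝ) - 1 / 6 = 5 / 6 by norm_num] at h
    have h2 : Real.Gamma (7 / 6) = 1 / 6 * Real.Gamma (1 / 6) := by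
      rw [← Real.Gamma_add_one (by norm_num)]; norm_num
    have := Real.pi_pos
    have h3 : √3 * (3 * √3) = 9 := by
      rw [mul_left_comm, Real.mul_self_sqrt (by norm_num)]; norm_num
    norm_num [raneyNumber_one, Nat.factorial]
    rw [h2, mul_assoc (1 / 6), h, h3]
    field_simp
    norm_num
  | more m ih _ =>
    have hr := raneyNumber_three_halves_add_two 1 m
    rw [ih] at hr
    have g1 : Real.Gamma (((m + 2 : ℕ) : ℝ) / 2 + 2 / 3) =
        ((m : ℝ) / 2 + 2 / 3) * Real.Gamma (m / 2 + 2 / 3) := by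
      rw [← Real.Gamma_add_one (by positivity)]; push_cast; ring_nf
    have g2 : Real.Gamma (((m + 2 : ℕ) : ℝ) / 2 + 1 / 3) =
        ((m : ℝ) / 2 + 1 / 3) * Real.Gamma (m / 2 + 1 / 3) := by
      rw [← Real.Gamma_add_one (by positivity)]; push_cast; ring_nf
    rw [g1, g2]
    have h3 : (3 * √3) ^ (m + 2) = (3 * √3) ^ m * 27 := by
      rw [pow_add, mul_pow _ _ 2, Real.sq_sqrt (by norm_num)]; norm_num
    rw [h3, Nat.factorial_succ (m + 2 + 1), Nat.factorial_succ (m + 2)]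
    have hpos : (0 : ℝ) < (m / 2 + 1 + 1) * ((m + 1) * (m + 2)) := by positivity
    rw [← mul_left_inj' hpos.ne', hr]
    have := Real.pi_pos
    have : ((m + 2).factorial : ℝ) ≠ 0 := by positivity
    push_cast
    generalize Real.Gamma (m / 2 + 2 / 3) = G1
    generalize Real.Gamma (m / 2 + 1 / 3) = G2
    field_simp
    ring

end RaneyNumber

/-! ### From moments to the unique measure and density. -/

section Density

theorem measurable_indicator_of_continuousOn_Ioo {f : ℝ → ℝ} {a b : ℝ}
    (hf : ContinuousOn f (Ioo a b)) : Measurable ((Ioo a b).indicator f) := by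
  classical
  rw [← Set.piecewise_eq_indicator]
  exact hf.measurable_piecewise continuousOn_const measurableSet_Ioo

/-- Measurability is not part of the structure, but comparing densities through `withDensity`
requires it. -/
theorem IsRaneyDensity.measurable {p r : ℝ} {W : ℝ → ℝ} (h : IsRaneyDensity p r W) :
    Measurable W := by
  have e : W = (Ioo 0 (raneyEndpoint p)).indicator W := by
    rw [eq_comm, Set.indicator_eq_self]
    intro x hx
    by_contra hn
    exact hx (h.eq_zero x hn)
  rw [e]
  exact measurable_indicator_of_continuousOn_Ioo h.continuousOn

/-- A nonnegative function on `(0, c(p))` whose moments are the Raney numbers is the density of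
the unique measure `μ(p,r)`. -/
theorem raney_of_moments {p r : ℝ} {F : ℝ → ℝ} (hc : 0 ≤ raneyEndpoint p)
    (hF : ContinuousOn F (Ioo 0 (raneyEndpoint p)))
    (h0 : ∀ x ∈ Ioo 0 (raneyEndpoint p), 0 ≤ F x)
    (hi : ∀ m : ℕ, IntegrableOn (fun x => x ^ m * F x) (Ioo 0 (raneyEndpoint p)))
    (hm : ∀ m : ℕ, ∫ x in Ioo 0 (raneyEndpoint p), x ^ m * F x = raneyNumber p r m) :
    (∃! μ : Measure ℝ, IsRaneyMeasure p r μ) ∧ (∃! W : ℝ → ℝ, IsRaneyDensity p r W) ∧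
      EqOn (raneyDensity p r) F (Ioo 0 (raneyEndpoint p)) := by
  set c := raneyEndpoint p
  set W : ℝ → ℝ := (Ioo 0 c).indicator F with hW
  have hWm : Measurable W := measurable_indicator_of_continuousOn_Ioo hF
  have hW0 : ∀ x, 0 ≤ W x := fun x => Set.indicator_nonneg h0 x
  have hWout : ∀ x, x ∉ Ioo 0 c → W x = 0 := fun x hx => Set.indicator_of_notMem hx F
  have hmul : ∀ m : ℕ, (fun x => W x * x ^ m) = (Ioo 0 c).indicator (fun x => x ^ m * F x) := by
    intro m
    funext x
    by_cases hx : x ∈ Ioo 0 c <;> simp [hW, hx, mul_comm]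
  have hWi : ∀ m : ℕ, Integrable (fun x => W x * x ^ m) := by
    intro m
    rw [hmul]
    exact (hi m).integrable_indicator measurableSet_Ioo
  have hWv : ∀ m : ℕ, ∫ x, W x * x ^ m = raneyNumber p r m := by
    intro m
    rw [hmul, integral_indicator measurableSet_Ioo, hm]
  set ν : Measure ℝ := volume.withDensity fun x => ENNReal.ofReal (W x) with hν
  have hdm : Measurable fun x => ENNReal.ofReal (W x) := hWm.ennreal_ofReal
  have htr : ∀ x, (ENNReal.ofReal (W x)).toReal = W x := fun x => ENNReal.toReal_ofReal (hW0 x)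
  have hfin : ∀ᵐ x : ℝ, ENNReal.ofReal (W x) < ⊤ := ae_of_all _ fun _ => ENNReal.ofReal_lt_top
  have hνi : ∀ m : ℕ, Integrable (fun x : ℝ => x ^ m) ν := by
    intro m
    rw [hν, integrable_withDensity_iff_integrable_smul' hdm hfin]
    simpa [htr] using hWi m
  have hνv : ∀ m : ℕ, ∫ x, x ^ m ∂ν = raneyNumber p r m := by
    intro m
    rw [hν, integral_withDensity_eq_integral_toReal_smul hdm hfin]
    simpa [htr] using hWv m
  have hνp : IsProbabilityMeasure ν := by
    refine ⟨?_⟩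
    have h1 : Integrable W := by simpa using hWi 0
    have h2 : ∫ x, W x = 1 := by simpa [raneyNumber_zero] using hWv 0
    rw [hν, withDensity_apply _ MeasurableSet.univ, setLIntegral_univ,
      ← ofReal_integral_eq_lintegral_ofReal h1 (ae_of_all _ hW0), h2, ENNReal.ofReal_one]
  have hνR : IsRaneyMeasure p r ν := ⟨hνp, hνi, hνv⟩
  have hνc : ∀ᵐ x ∂ν, |x| ≤ c := by
    rw [hν, ae_withDensity_iff hdm]
    refine ae_of_all _ fun x hx => ?_
    have : x ∈ Ioo 0 c := by
      by_contra hn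
      exact hx (by simp [hWout x hn])
    rw [abs_of_pos this.1]
    exact this.2.le
  have huniq : ∀ μ : Measure ℝ, IsRaneyMeasure p r μ → μ = ν := by
    intro μ hμ
    have := hμ.isProbabilityMeasure
    exact eq_of_moments_eq_of_ae_abs_le hc hνc hμ.integrable_pow hνi
      fun m => (hμ.moment_eq m).trans (hνv m).symm
  -- Existence makes the `epsilon` choice satisfy the predicate; uniqueness then identifies it.
  have hraney : raneyMeasure p r = ν := huniq _ (Classical.epsilon_spec ⟨ν, hνR⟩)
  have hFW : EqOn W F (Ioo 0 c) := fun x hx => Set.indicator_of_mem hx F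
  have hWR : IsRaneyDensity p r W := ⟨hF.congr hFW, hWout, hW0, hraney.symm⟩
  have huniqW : ∀ V : ℝ → ℝ, IsRaneyDensity p r V → V = W := by
    intro V hV
    have hae : (fun x => ENNReal.ofReal (V x)) =ᵐ[volume] fun x => ENNReal.ofReal (W x) := by
      rw [← withDensity_eq_iff_of_sigmaFinite hV.measurable.ennreal_ofReal.aemeasurable
        hdm.aemeasurable, hV.withDensity_eq, hraney]
    have hae' : V =ᵐ[volume] W := by
      filter_upwards [hae] with x hx
      exact (ENNReal.ofReal_eq_ofReal_iff (hV.nonneg x) (hW0 x)).1 hx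
    -- Continuity on the open interval upgrades almost everywhere equality to equality at every
    -- point.
    have hon : EqOn V W (Ioo 0 c) :=
      Measure.eqOn_open_of_ae_eq (ae_restrict_of_ae hae') isOpen_Ioo hV.continuousOn
        hWR.continuousOn
    funext x
    by_cases hx : x ∈ Ioo 0 c
    · exact hon hx
    · rw [hV.eq_zero x hx, hWout x hx]
  have hdens : raneyDensity p r = W := huniqW _ (Classical.epsilon_spec ⟨W, hWR⟩)
  exact ⟨⟨ν, hνR, huniq⟩, ⟨W, hWR, huniqW⟩, hdens ▸ hFW⟩

end Density

/-! ### The explicit densities for `p = 3/2`. -/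

section ThreeHalves

theorem raneyEndpoint_three_halves : raneyEndpoint (3 / 2) = 3 * √3 / 2 := by
  have h1 : (3 / 2 : ℝ) ^ (3 / 2 : ℝ) = 3 / 2 * √(3 / 2) := by
    rw [show (3 / 2 : ℝ) = 1 + 1 / 2 by norm_num, Real.rpow_add (by norm_num), Real.rpow_one,
      Real.sqrt_eq_rpow]
  have h2 : (3 / 2 - 1 : ℝ) ^ (1 - 3 / 2 : ℝ) = √2 := by
    rw [show (3 / 2 - 1 : ℝ) = 2⁻¹ by norm_num, show (1 - 3 / 2 : ℝ) = -(1 / 2) by norm_num,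
      Real.rpow_neg (by norm_num), Real.inv_rpow (by norm_num), inv_inv, Real.sqrt_eq_rpow]
  rw [raneyEndpoint, h1, h2, mul_assoc, ← Real.sqrt_mul (by norm_num)]
  norm_num
  ring

/-- The difference of powers that occurs in the densities for `p = 3/2`. -/
noncomputable def powDiff (α x : ℝ) : ℝ :=
  (1 + √(1 - 4 * x ^ 2 / 27)) ^ α - (1 - √(1 - 4 * x ^ 2 / 27)) ^ α

theorem four_mul_sq_div (x : ℝ) : 4 * x ^ 2 / 27 = x ^ 2 / (3 * √3 / 2) ^ 2 := by
  rw [div_pow, mul_pow, Real.sq_sqrt (by norm_num)]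
  ring

theorem sqrt_mem_of_mem {x : ℝ} (hx : x ∈ Ioo (0 : ℝ) (3 * √3 / 2)) :
    √(1 - 4 * x ^ 2 / 27) ∈ Ioo (0 : ℝ) 1 := by
  rw [four_mul_sq_div]
  exact sqrt_one_sub_mem hx

theorem powDiff_nonneg {α x : ℝ} (hα : 0 ≤ α) (hx : x ∈ Ioo (0 : ℝ) (3 * √3 / 2)) :
    0 ≤ powDiff α x := by
  obtain ⟨h0, h1⟩ := sqrt_mem_of_mem hx
  exact sub_nonneg.2 (Real.rpow_le_rpow (by linarith) (by linarith) hα)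

theorem continuous_powDiff {α : ℝ} (hα : 0 ≤ α) : Continuous (powDiff α) := by
  unfold powDiff
  exact ((by fun_prop : Continuous fun x : ℝ => 1 + √(1 - 4 * x ^ 2 / 27)).rpow_const
    fun _ => Or.inr hα).sub ((by fun_prop : Continuous fun x : ℝ =>
      1 - √(1 - 4 * x ^ 2 / 27)).rpow_const fun _ => Or.inr hα)

theorem integral_rpow_mul_powDiff {β α : ℝ} (hβ : -1 < β) (hα : 0 < α) :
    IntegrableOn (fun x : ℝ => x ^ β * powDiff α x) (Ioo 0 (3 * √3 / 2)) ∧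
    ∫ x in Ioo 0 (3 * √3 / 2), x ^ β * powDiff α x =
      (3 * √3 / 2) ^ (β + 1) * 2 ^ (β + α) *
        (α * Real.Gamma ((β + 1) / 2 + α) * Real.Gamma ((β + 1) / 2) /
          Real.Gamma (β + α + 2)) := by
  simp only [powDiff, four_mul_sq_div]
  exact integral_rpow_mul_sub (by positivity) hβ hα

theorem three_sqrt_three_rpow (s : ℝ) :
    (3 * √3 / 2) ^ s = (3 : ℝ) ^ (3 / 2 * s) / (2 : ℝ) ^ s := by
  rw [Real.div_rpow (by positivity) (by norm_num), Real.rpow_mul (by norm_num)]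
  congr 2
  rw [show (3 / 2 : ℝ) = 1 + 1 / 2 by norm_num, Real.rpow_add (by norm_num), Real.rpow_one,
    Real.sqrt_eq_rpow]

theorem three_sqrt_three_pow (m : ℕ) : (3 * √3) ^ m = (3 : ℝ) ^ (3 / 2 * m : ℝ) := by
  rw [Real.rpow_mul (by norm_num), Real.rpow_natCast]
  congr 1
  rw [show (3 / 2 : ℝ) = 1 + 1 / 2 by norm_num, Real.rpow_add (by norm_num), Real.rpow_one,
    Real.sqrt_eq_rpow]

/-- The density for `r = 1/2`. -/
noncomputable def halfDensity (x : ℝ) : ℝ :=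
  powDiff (2 / 3) x /
    ((2 : ℝ) ^ (5 / 3 : ℝ) * (3 : ℝ) ^ (-(1 / 2) : ℝ) * Real.pi * x ^ (2 / 3 : ℝ))

/-- The density for `r = 1`. -/
noncomputable def oneDensity (x : ℝ) : ℝ :=
  (3 : ℝ) ^ (1 / 2 : ℝ) * (powDiff (1 / 3) x / ((2 : ℝ) ^ (4 / 3 : ℝ) * Real.pi * x ^ (1 / 3 : ℝ))) +
    (3 : ℝ) ^ (1 / 2 : ℝ) * x ^ (1 / 3 : ℝ) *
      (powDiff (2 / 3) x / ((2 : ℝ) ^ (5 / 3 : ℝ) * Real.pi))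

theorem pow_mul_halfDensity {x : ℝ} (hx : 0 < x) (m : ℕ) :
    (2 ^ (5 / 3 : ℝ) * 3 ^ (-(1 / 2) : ℝ) * Real.pi)⁻¹ *
      (x ^ ((m : ℝ) - 2 / 3) * powDiff (2 / 3) x) = x ^ m * halfDensity x := by
  rw [halfDensity, Real.rpow_sub hx, Real.rpow_natCast]
  field_simp

theorem pow_mul_oneDensity {x : ℝ} (hx : 0 < x) (m : ℕ) :
    3 ^ (1 / 2 : ℝ) / (2 ^ (4 / 3 : ℝ) * Real.pi) *
        (x ^ ((m : ℝ) - 1 / 3) * powDiff (1 / 3) x) +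
      3 ^ (1 / 2 : ℝ) / (2 ^ (5 / 3 : ℝ) * Real.pi) *
        (x ^ ((m : ℝ) + 1 / 3) * powDiff (2 / 3) x) = x ^ m * oneDensity x := by
  rw [oneDensity, Real.rpow_sub hx, Real.rpow_add hx, Real.rpow_natCast]
  field_simp

theorem Gamma_natCast_add_two (m : ℕ) : Real.Gamma ((m : ℝ) + 2) = (m + 1).factorial := by
  rw [← Real.Gamma_nat_eq_factorial]
  push_cast
  ring_nf

theorem moment_halfDensity (m : ℕ) :
    IntegrableOn (fun x => x ^ m * halfDensity x) (Ioo 0 (3 * √3 / 2)) ∧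
    ∫ x in Ioo 0 (3 * √3 / 2), x ^ m * halfDensity x = raneyNumber (3 / 2) (1 / 2) m := by
  have hm : (0 : ℝ) ≤ m := m.cast_nonneg
  -- The factor `x ^ (2/3)` in the denominator gives `β = m - 2/3`. Then `β + α = m`, so the Gamma
  -- value in the denominator is a factorial.
  obtain ⟨hi, hv⟩ := integral_rpow_mul_powDiff (β := (m : ℝ) - 2 / 3) (α := 2 / 3)
    (by linarith) (by norm_num)
  have e : EqOn (fun x => (2 ^ (5 / 3 : ℝ) * 3 ^ (-(1 / 2) : ℝ) * Real.pi)⁻¹ *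
      (x ^ ((m : ℝ) - 2 / 3) * powDiff (2 / 3) x)) (fun x => x ^ m * halfDensity x)
      (Ioo 0 (3 * √3 / 2)) := fun x hx => pow_mul_halfDensity hx.1 m
  refine ⟨IntegrableOn.congr_fun (Integrable.const_mul hi _) e measurableSet_Ioo, ?_⟩
  rw [← setIntegral_congr_fun measurableSet_Ioo e, integral_const_mul, hv,
    raneyNumber_half_eq_Gamma, three_sqrt_three_rpow, three_sqrt_three_pow,
    show (m : ℝ) - 2 / 3 + 2 / 3 + 2 = m + 2 by ring, Gamma_natCast_add_two,
    show ((m : ℝ) - 2 / 3 + 1) / 2 + 2 / 3 = m / 2 + 5 / 6 by ring,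
    show ((m : ℝ) - 2 / 3 + 1) / 2 = m / 2 + 1 / 6 by ring,
    show (m : ℝ) - 2 / 3 + 2 / 3 = m by ring]
  have h3 : (3 : ℝ) ^ (3 / 2 * ((m : ℝ) - 2 / 3 + 1)) =
      3 * 3 ^ (3 / 2 * m : ℝ) * 3 ^ (-(1 / 2) : ℝ) := by
    rw [← Real.rpow_one_add' (by norm_num) (by positivity), ← Real.rpow_add (by norm_num)]
    ring_nf
  have h2 : (2 : ℝ) ^ (5 / 3 : ℝ) * 2 ^ ((m : ℝ) - 2 / 3 + 1) = 4 * 2 ^ (m : ℝ) := by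
    rw [← Real.rpow_add (by norm_num), show (4 : ℝ) = 2 ^ (2 : ℝ) by norm_num,
      ← Real.rpow_add (by norm_num)]
    ring_nf
  have := Real.pi_pos
  have : (0 : ℝ) < 2 ^ (5 / 3 : ℝ) := by positivity
  have : (0 : ℝ) < 2 ^ ((m : ℝ) - 2 / 3 + 1) := by positivity
  have hne : (3 : ℝ) ^ (-(1 / 2) : ℝ) ≠ 0 := by positivity
  have : ((m + 1).factorial : ℝ) ≠ 0 := by positivity
  rw [h3]
  generalize (3 : ℝ) ^ (-(1 / 2) : ℝ) = u at *
  generalize (2 : ℝ) ^ (5 / 3 : ℝ) = v at *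
  generalize (2 : ℝ) ^ ((m : ℝ) - 2 / 3 + 1) = w at *
  rw [show ∀ X Y Z : ℝ, (v * u * Real.pi)⁻¹ * (3 * X * u / w * Y * Z) =
    3 * X * Y * Z / ((v * w) * Real.pi) by intro X Y Z; field_simp, h2]
  field_simp
  norm_num

theorem moment_oneDensity (m : ℕ) :
    IntegrableOn (fun x => x ^ m * oneDensity x) (Ioo 0 (3 * √3 / 2)) ∧
    ∫ x in Ioo 0 (3 * √3 / 2), x ^ m * oneDensity x = raneyNumber (3 / 2) 1 m := by
  have hm : (0 : ℝ) ≤ m := m.cast_nonneg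
  obtain ⟨hi, hv⟩ := integral_rpow_mul_powDiff (β := (m : ℝ) - 1 / 3) (α := 1 / 3)
    (by linarith) (by norm_num)
  obtain ⟨hi', hv'⟩ := integral_rpow_mul_powDiff (β := (m : ℝ) + 1 / 3) (α := 2 / 3)
    (by linarith) (by norm_num)
  have e : EqOn (fun x => 3 ^ (1 / 2 : ℝ) / (2 ^ (4 / 3 : ℝ) * Real.pi) *
        (x ^ ((m : ℝ) - 1 / 3) * powDiff (1 / 3) x) +
      3 ^ (1 / 2 : ℝ) / (2 ^ (5 / 3 : ℝ) * Real.pi) *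
        (x ^ ((m : ℝ) + 1 / 3) * powDiff (2 / 3) x)) (fun x => x ^ m * oneDensity x)
      (Ioo 0 (3 * √3 / 2)) := fun x hx => pow_mul_oneDensity hx.1 m
  refine ⟨IntegrableOn.congr_fun ((Integrable.const_mul hi _).add (Integrable.const_mul hi' _)) e
    measurableSet_Ioo, ?_⟩
  -- With this shift both terms of the density produce the product `Γ(m/2 + 2/3) Γ(m/2 + 1/3)`. The
  -- rational coefficients then add up through `1 + (3 m + 2) / (m + 2) = 4 (m + 1) / (m + 2)`.
  have g : Real.Gamma ((m : ℝ) / 2 + 4 / 3) =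
      ((m : ℝ) / 2 + 1 / 3) * Real.Gamma (m / 2 + 1 / 3) := by
    rw [← Real.Gamma_add_one (by positivity)]; ring_nf
  have g3 : Real.Gamma ((m : ℝ) + 3) = (m + 2) * (m + 1).factorial := by
    rw [← Gamma_natCast_add_two, ← Real.Gamma_add_one (by positivity)]; ring_nf
  have p1 : (3 : ℝ) ^ (1 / 2 : ℝ) / (2 ^ (4 / 3 : ℝ) * Real.pi) *
      ((3 : ℝ) ^ (3 / 2 * ((m : ℝ) - 1 / 3 + 1)) / 2 ^ ((m : ℝ) - 1 / 3 + 1) * 2 ^ (m : ℝ)) =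
      √3 * 3 ^ (3 / 2 * m : ℝ) * 3 / (4 * Real.pi) := by
    have h3 : (3 : ℝ) ^ (3 / 2 * ((m : ℝ) - 1 / 3 + 1)) = 3 ^ (3 / 2 * m : ℝ) * 3 := by
      rw [← Real.rpow_add_one (by norm_num)]; ring_nf
    have h2 : (2 : ℝ) ^ (4 / 3 : ℝ) * 2 ^ ((m : ℝ) - 1 / 3 + 1) = 4 * 2 ^ (m : ℝ) := by
      rw [← Real.rpow_add (by norm_num), show (4 : ℝ) = 2 ^ (2 : ℝ) by norm_num,
        ← Real.rpow_add (by norm_num)]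
      ring_nf
    rw [h3, ← Real.sqrt_eq_rpow, show ∀ a b c d e f : ℝ, a / (b * c) * (d / e * f) =
      a * d * f / ((b * e) * c) by intros; ring, h2]
    field_simp
  have p2 : (3 : ℝ) ^ (1 / 2 : ℝ) / (2 ^ (5 / 3 : ℝ) * Real.pi) *
      ((3 : ℝ) ^ (3 / 2 * ((m : ℝ) + 1 / 3 + 1)) / 2 ^ ((m : ℝ) + 1 / 3 + 1) * 2 ^ ((m : ℝ) + 1)) =
      √3 * 3 ^ (3 / 2 * m : ℝ) * 9 / (4 * Real.pi) := by
    have h3 : (3 : ℝ) ^ (3 / 2 * ((m : ℝ) + 1 / 3 + 1)) = 3 ^ (3 / 2 * m : ℝ) * 9 := by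
      rw [show (9 : ℝ) = 3 ^ (2 : ℝ) by norm_num, ← Real.rpow_add (by norm_num)]; ring_nf
    have h2 : (2 : ℝ) ^ (5 / 3 : ℝ) * 2 ^ ((m : ℝ) + 1 / 3 + 1) = 4 * 2 ^ ((m : ℝ) + 1) := by
      rw [← Real.rpow_add (by norm_num), show (4 : ℝ) = 2 ^ (2 : ℝ) by norm_num,
        ← Real.rpow_add (by norm_num)]
      ring_nf
    rw [h3, ← Real.sqrt_eq_rpow, show ∀ a b c d e f : ℝ, a / (b * c) * (d / e * f) =
      a * d * f / ((b * e) * c) by intros; ring, h2]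
    field_simp
  rw [← setIntegral_congr_fun measurableSet_Ioo e, integral_add (Integrable.const_mul hi _)
    (Integrable.const_mul hi' _), integral_const_mul, integral_const_mul, hv, hv',
    raneyNumber_one_eq_Gamma, three_sqrt_three_rpow, three_sqrt_three_rpow, three_sqrt_three_pow,
    show (m : ℝ) - 1 / 3 + 1 / 3 + 2 = m + 2 by ring, Gamma_natCast_add_two,
    show ((m : ℝ) - 1 / 3 + 1) / 2 + 1 / 3 = m / 2 + 2 / 3 by ring,
    show ((m : ℝ) - 1 / 3 + 1) / 2 = m / 2 + 1 / 3 by ring,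
    show (m : ℝ) - 1 / 3 + 1 / 3 = m by ring,
    show (m : ℝ) + 1 / 3 + 2 / 3 + 2 = m + 3 by ring, g3,
    show ((m : ℝ) + 1 / 3 + 1) / 2 + 2 / 3 = m / 2 + 4 / 3 by ring, g,
    show ((m : ℝ) + 1 / 3 + 1) / 2 = m / 2 + 2 / 3 by ring,
    show (m : ℝ) + 1 / 3 + 2 / 3 = m + 1 by ring, ← mul_assoc, p1, ← mul_assoc, p2,
    Nat.factorial_succ (m + 1)]
  have := Real.pi_pos
  have : ((m + 1).factorial : ℝ) ≠ 0 := by positivity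
  generalize Real.Gamma (m / 2 + 2 / 3) = G1
  generalize Real.Gamma (m / 2 + 1 / 3) = G2
  push_cast
  field_simp
  ring

theorem halfDensity_nonneg {x : ℝ} (hx : x ∈ Ioo (0 : ℝ) (3 * √3 / 2)) : 0 ≤ halfDensity x := by
  have := powDiff_nonneg (α := 2 / 3) (by norm_num) hx
  have := hx.1
  rw [halfDensity]
  positivity

theorem oneDensity_nonneg {x : ℝ} (hx : x ∈ Ioo (0 : ℝ) (3 * √3 / 2)) : 0 ≤ oneDensity x := by
  have := powDiff_nonneg (α := 1 / 3) (by norm_num) hx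
  have := powDiff_nonneg (α := 2 / 3) (by norm_num) hx
  have := hx.1
  rw [oneDensity]
  positivity

theorem continuousOn_halfDensity : ContinuousOn halfDensity (Ioo 0 (3 * √3 / 2)) := by
  refine (continuous_powDiff (by norm_num)).continuousOn.div ?_ fun x hx => ?_
  · exact continuousOn_const.mul (continuousOn_id.rpow_const fun x hx => Or.inl hx.1.ne')
  · have := Real.rpow_pos_of_pos hx.1 (2 / 3)
    positivity

theorem continuousOn_oneDensity : ContinuousOn oneDensity (Ioo 0 (3 * √3 / 2)) := by
  have hr : ContinuousOn (fun x : ℝ => x ^ (1 / 3 : ℝ)) (Ioo 0 (3 * √3 / 2)) :=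
    continuousOn_id.rpow_const fun x hx => Or.inl hx.1.ne'
  refine (continuousOn_const.mul ((continuous_powDiff (by norm_num)).continuousOn.div
    (continuousOn_const.mul hr) fun x hx => ?_)).add ((continuousOn_const.mul hr).mul
      ((continuous_powDiff (by norm_num)).continuousOn.div_const _))
  exact mul_ne_zero (by positivity) (Real.rpow_pos_of_pos hx.1 (1 / 3)).ne'

theorem raney_three_halves_half :
    (∃! μ : Measure ℝ, IsRaneyMeasure (3 / 2) (1 / 2) μ) ∧
      (∃! W : ℝ → ℝ, IsRaneyDensity (3 / 2) (1 / 2) W) ∧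
      EqOn (raneyDensity (3 / 2) (1 / 2)) halfDensity (Ioo 0 (3 * √3 / 2)) := by
  rw [← raneyEndpoint_three_halves]
  apply raney_of_moments <;> rw [raneyEndpoint_three_halves]
  · positivity
  · exact continuousOn_halfDensity
  · exact fun x hx => halfDensity_nonneg hx
  · exact fun m => (moment_halfDensity m).1
  · exact fun m => (moment_halfDensity m).2

theorem raney_three_halves_one :
    (∃! μ : Measure ℝ, IsRaneyMeasure (3 / 2) 1 μ) ∧
      (∃! W : ℝ → ℝ, IsRaneyDensity (3 / 2) 1 W) ∧
      EqOn (raneyDensity (3 / 2) 1) oneDensity (Ioo 0 (3 * √3 / 2)) := by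
  rw [← raneyEndpoint_three_halves]
  apply raney_of_moments <;> rw [raneyEndpoint_three_halves]
  · positivity
  · exact continuousOn_oneDensity
  · exact fun x hx => oneDensity_nonneg hx
  · exact fun m => (moment_oneDensity m).1
  · exact fun m => (moment_oneDensity m).2

/-- The extra factor `x` shifts the moments of the `r = 1` density by one, matching
`raneyNumber_self_eq`. -/
theorem raney_three_halves_three_halves :
    (∃! μ : Measure ℝ, IsRaneyMeasure (3 / 2) (3 / 2) μ) ∧
      (∃! W : ℝ → ℝ, IsRaneyDensity (3 / 2) (3 / 2) W) ∧
      EqOn (raneyDensity (3 / 2) (3 / 2)) (fun x => x * oneDensity x) (Ioo 0 (3 * √3 / 2)) := by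
  rw [← raneyEndpoint_three_halves]
  apply raney_of_moments <;> rw [raneyEndpoint_three_halves]
  · positivity
  · exact continuousOn_id.mul continuousOn_oneDensity
  · exact fun x hx => mul_nonneg hx.1.le (oneDensity_nonneg hx)
  · intro m
    simpa only [pow_succ, mul_assoc] using (moment_oneDensity (m + 1)).1
  · intro m
    rw [raneyNumber_self_eq]
    simpa only [pow_succ, mul_assoc] using (moment_oneDensity (m + 1)).2

end ThreeHalves

theorem mainTheorem6 :
    -- the measures and densities in question exist and are unique
    (∀ r : ℝ, r = 1 / 2 ∨ r = 1 ∨ r = 3 / 2 →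
      (∃! μ : Measure ℝ, IsRaneyMeasure (3 / 2) r μ) ∧
      (∃! W : ℝ → ℝ, IsRaneyDensity (3 / 2) r W)) ∧
    -- they are given on the interval (0, 3√3/2) by the following formulas
    ∀ x ∈ Ioo (0 : ℝ) (3 * √3 / 2),
      raneyDensity (3 / 2) (1 / 2) x =
        ((1 + √(1 - 4 * x ^ 2 / 27)) ^ (2 / 3 : ℝ) - (1 - √(1 - 4 * x ^ 2 / 27)) ^ (2 / 3 : ℝ)) /
          ((2 : ℝ) ^ (5 / 3 : ℝ) * (3 : ℝ) ^ (-(1 / 2) : ℝ) * Real.pi * x ^ (2 / 3 : ℝ)) ∧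
      raneyDensity (3 / 2) 1 x =
        (3 : ℝ) ^ (1 / 2 : ℝ) *
            (((1 + √(1 - 4 * x ^ 2 / 27)) ^ (1 / 3 : ℝ) -
                (1 - √(1 - 4 * x ^ 2 / 27)) ^ (1 / 3 : ℝ)) /
              ((2 : ℝ) ^ (4 / 3 : ℝ) * Real.pi * x ^ (1 / 3 : ℝ))) +
          (3 : ℝ) ^ (1 / 2 : ℝ) * x ^ (1 / 3 : ℝ) *
            (((1 + √(1 - 4 * x ^ 2 / 27)) ^ (2 / 3 : ℝ) -
                (1 - √(1 - 4 * x ^ 2 / 27)) ^ (2 / 3 : ℝ)) /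
              ((2 : ℝ) ^ (5 / 3 : ℝ) * Real.pi)) ∧
      raneyDensity (3 / 2) (3 / 2) x = x * raneyDensity (3 / 2) 1 x := by
  refine ⟨?_, fun x hx => ⟨raney_three_halves_half.2.2 hx, raney_three_halves_one.2.2 hx, ?_⟩⟩
  · rintro r (rfl | rfl | rfl)
    · exact ⟨raney_three_halves_half.1, raney_three_halves_half.2.1⟩
    · exact ⟨raney_three_halves_one.1, raney_three_halves_one.2.1⟩
    · exact ⟨raney_three_halves_three_halves.1, raney_three_halves_three_halves.2.1⟩
  · rw [raney_three_halves_three_halves.2.2 hx, raney_three_halves_one.2.2 hx]
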